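/- For a field $\mathbb{F}$ and $N \in \mathbb{N}$ let $$\langle N,N,N\rangle = \sum_{i,j,k=1}^{N} x_{i,j}\, y_{j,k}\, z_{k,i}$$ be the $N \times N$ matrix multiplication tensor over $\mathbb{F}$. A zeroing out of a tensor $T = \sum_{a \in A, b \in B, c \in C} T_{a,b,c}\, x_a y_b z_c$ is a tensor obtained from $T$ by choosing subsets $A' \subseteq A$, $B' \subseteq B$, $C' \subseteq C$ and setting to zero all coefficients $T_{a,b,c}$ with $(a,b,c) \notin A' \times B' \times C'$. A permutation of an identity tensor of size $k$ is a $\{0,1\}$-valued tensor with exactly $k$ non-zero coefficients in which every $a \in A$, every $b \in B$ and every $c \in C$ occurs in at most one non-zero term. The zeroing-out subrank $Q_{zo}(T)$ is the maximum $k$ such that $T$ has a zeroing out that is a permutation of an identity tensor of size $k$. Let $\log^* x$ be the number of times that $\log_2$ has to be applied, starting from $x$, until the result is at most $1$ (so $\log^* x = 0$ for $x \le 1$). Theorem. There is an absolute constant $c > 0$ such that, for every field $\mathbb{F}$ and every $N \in \mathbb{N}$, $$Q_{zo}(\langle N,N,N\rangle) \le \frac{N^{2}}{2^{c \log^* N}}.$$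 In particular, for every field $\mathbb{F}$, $Q_{zo}(\langle N,N,N\rangle) = o(N^2)$ as $N \to \infty$. -/

import Mathlib

noncomputable section

/-- An order-3 tensor `∑ T a b c • x_a y_b z_c`, given by its coefficients. -/
abbrev Tensor3 (F A B C : Type*) := A → B → C → F

namespace Tensor3

variable {F A B C : Type*} [Field F]

/-- The set of index triples with a non-zero coefficient. -/
def supp (T : Tensor3 F A B C) : Set (A × B × C) :=
  {t | T t.1 t.2.1 t.2.2 ≠ 0}

open Classical in
/-- The zeroing out `T|_{A', B', C'}`: coefficients outside `A' × B' × C'` are set to zero. -/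
def zeroOut (T : Tensor3 F A B C) (A' : Set A) (B' : Set B) (C' : Set C) : Tensor3 F A B C :=
  fun a b c => if a ∈ A' ∧ b ∈ B' ∧ c ∈ C' then T a b c else 0

/-- `T` is a permutation of an identity tensor of size `k`: its coefficients are `0` or `1`, every
index of each of the three axes occurs in at most one non-zero term, and there are exactly `k`
non-zero terms. -/
structure IsPermIdentity (T : Tensor3 F A B C) (k : ℕ) : Prop where
  zero_or_one : ∀ a b c, T a b c = 0 ∨ T a b c = 1
  fst_unique : ∀ a b c b' c', T a b c ≠ 0 → T a b' c' ≠ 0 → b = b' ∧ c = c'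
  snd_unique : ∀ a b c a' c', T a b c ≠ 0 → T a' b c' ≠ 0 → a = a' ∧ c = c'
  trd_unique : ∀ a b c a' b', T a b c ≠ 0 → T a' b' c ≠ 0 → a = a' ∧ b = b'
  finite_supp : (supp T).Finite
  ncard_supp : (supp T).ncard = k

/-- The sizes of the permuted identity tensors that are zeroings out of `T`. -/
def zeroOutSizes (T : Tensor3 F A B C) : Set ℕ :=
  {k | ∃ (A' : Set A) (B' : Set B) (C' : Set C), IsPermIdentity (zeroOut T A' B' C') k}

/-- The zeroing-out subrank: the maximum `k` such that `T` has a zeroing out to a permutation of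
an identity tensor of size `k`. -/
def zeroOutSubrank (T : Tensor3 F A B C) : ℕ :=
  sSup (zeroOutSizes T)

/-- For finite index types the maximum exists, so the supremum above is attained. -/
theorem isGreatest_zeroOutSubrank [Finite A] [Finite B] [Finite C] (T : Tensor3 F A B C) :
    IsGreatest (zeroOutSizes T) (zeroOutSubrank T) := by
  have hne : (zeroOutSizes T).Nonempty := by
    refine ⟨0, ∅, ∅, ∅, ?_⟩
    constructor <;> simp [zeroOut, supp]
  have hbd : BddAbove (zeroOutSizes T) := by
    refine ⟨Nat.card (A × B × C), ?_⟩
    rintro k ⟨A', B', C', h⟩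
    rw [← h.ncard_supp]
    exact Set.ncard_le_card _
  exact ⟨Nat.sSup_mem hne hbd, fun k hk => le_csSup hbd hk⟩

end Tensor3

/-- The matrix multiplication tensor `⟨n, m, p⟩ = ∑ i j k, x_{i,j} y_{j,k} z_{k,i}`. -/
def matMulTensor (F : Type*) [Field F] (n m p : ℕ) :
    Tensor3 F (Fin n × Fin m) (Fin m × Fin p) (Fin p × Fin n) :=
  fun a b c => if a.2 = b.1 ∧ b.2 = c.1 ∧ c.2 = a.1 then 1 else 0

/-- The iterated logarithm `log* x`: how many times the binary logarithm has to be applied,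
starting from `x`, until the result is at most `1`. -/
def logStar (x : ℝ) : ℕ :=
  sInf {k : ℕ | (Real.logb 2)^[k] x ≤ 1}

/-- Iterating the binary logarithm does reach a value at most `1`, and `logStar x` is the first
time at which it does. -/
theorem isLeast_logStar (x : ℝ) :
    IsLeast {k : ℕ | (Real.logb 2)^[k] x ≤ 1} (logStar x) := by
  have key : ∀ (n : ℕ) (y : ℝ), y ≤ n + 1 → ∃ k : ℕ, (Real.logb 2)^[k] y ≤ 1 := by
    intro n
    induction n with
    | zero => intro y hy; exact ⟨0, by simpa using hy⟩
    | succ n ih =>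
      intro y hy
      by_cases h1 : y ≤ 1
      · exact ⟨0, by simpa using h1⟩
      push Not at h1
      have hpow : y ≤ (2 : ℝ) ^ ((n : ℝ) + 1) := by
        have h2 : n + 2 ≤ 2 ^ (n + 1) := Nat.lt_two_pow_self (n := n + 1)
        have h3 : ((n : ℝ) + 2) ≤ 2 ^ (n + 1) := by exact_mod_cast h2
        have h4 : (2 : ℝ) ^ ((n : ℝ) + 1) = 2 ^ (n + 1) := by
          rw [← Real.rpow_natCast]; push_cast; rfl
        rw [h4]; push_cast at hy; linarith
      have hlog : Real.logb 2 y ≤ n + 1 :=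
        (Real.logb_le_iff_le_rpow (by norm_num) (by linarith)).2 hpow
      obtain ⟨k, hk⟩ := ih _ hlog
      exact ⟨k + 1, by simpa [Function.iterate_succ_apply] using hk⟩
  obtain ⟨n, hn⟩ := exists_nat_ge x
  have hne : {k : ℕ | (Real.logb 2)^[k] x ≤ 1}.Nonempty := key n x (by linarith)
  exact ⟨Nat.sInf_mem hne, fun k hk => Nat.sInf_le hk⟩

end

/-! A non-zero term of the matrix multiplication tensor is a triangle on three copies of `Fin N`,
its three variables are the edges, and a zeroing out keeps some edges. If the result is a permuted
identity, the surviving triangles are edge-disjoint and are the only triangles in their union. So it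
suffices that a system of `d * n ^ 2` such triangles forces `log* n = O(log (1 / d))`. This is a
triangle removal argument driven by entropy.

Partition the first class by neighbourhoods in a set `S` of vertices of the third class. The sum of
`t * log t` over the densities from cells to vertices lies between `2 * d * n ^ 2 * log d` and `0`.
It never decreases under refinement, and it gains wherever a density halves (`entropy_increment`).
If `z` is joined to `x` and `y`, adding `z` to `S` makes the whole cell of `x` adjacent to `z`. Each
neighbour of `y` in that cell then closes a triangle on the edge `yz`, so there is at most one, and
the density collapses (`dropY_ge`).

It remains to find few vertices that cover a fixed share of the pairs. Averaging over `z`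
(`sum_uncovered_sub_ge`) shows that, unless the densities to the third class drop, which is also a
gain, one vertex covers a share `d ^ 3 / 2 ^ (#S + 17)`. Greedy choice thus refines with
exponentially many vertices in `#S` (`exists_entropy_increment`), and `O(log (1 / d))` rounds
exhaust the entropy, giving a tower bound (`card_lt`). Its additive constants are absorbed because
`d` stays away from `1` (`density_le`). -/

noncomputable section

open Finset

open scoped Classical

namespace TriangleSystem

/-! ### Averages over the cells of a partition, and convexity -/

section CellAverage

variable {V K K' : Type*} [Fintype V]

/-- The indicator of a proposition. -/
def ind (p : Prop) : ℝ := if p then 1 else 0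

lemma ind_of {p : Prop} (h : p) : ind p = 1 := if_pos h

lemma ind_of_not {p : Prop} (h : ¬ p) : ind p = 0 := if_neg h

lemma ind_nonneg (p : Prop) : 0 ≤ ind p := by
  unfold ind
  split_ifs <;> norm_num

lemma ind_le_one (p : Prop) : ind p ≤ 1 := by
  unfold ind
  split_ifs <;> norm_num

/-- The size of the fibre of `c` through `x`. -/
def cellCard (c : V → K) (x : V) : ℝ := #{x' | c x' = c x}

/-- The average of `g` over the fibre of `c` through `x`. -/
def cellAvg (c : V → K) (g : V → ℝ) (x : V) : ℝ :=
  (∑ x' with c x' = c x, g x') / cellCard c x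

lemma cellCard_pos (c : V → K) (x : V) : 0 < cellCard c x := by
  unfold cellCard
  exact_mod_cast Finset.card_pos.2 ⟨x, by simp⟩

lemma cellCard_congr {c : V → K} {x y : V} (h : c x = c y) : cellCard c x = cellCard c y := by
  simp only [cellCard, h]

lemma cellAvg_nonneg {c : V → K} {g : V → ℝ} (hg : ∀ x, 0 ≤ g x) (x : V) :
    0 ≤ cellAvg c g x :=
  div_nonneg (sum_nonneg fun _ _ => hg _) (cellCard_pos c x).le

lemma cellAvg_le_one {c : V → K} {g : V → ℝ} (hg : ∀ x, g x ≤ 1) (x : V) :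
    cellAvg c g x ≤ 1 := by
  rw [cellAvg, div_le_one (cellCard_pos c x)]
  calc (∑ x' with c x' = c x, g x') ≤ ∑ x' with c x' = c x, (1 : ℝ) :=
        sum_le_sum fun _ _ => hg _
    _ = _ := by simp [cellCard]

lemma cellAvg_congr {c : V → K} {g : V → ℝ} {x y : V} (h : c x = c y) :
    cellAvg c g x = cellAvg c g y := by
  simp only [cellAvg, cellCard, h]

lemma cellAvg_sum {ι : Type*} (s : Finset ι) (c : V → K) (g : ι → V → ℝ) (x : V) :
    cellAvg c (fun x => ∑ i ∈ s, g i x) x = ∑ i ∈ s, cellAvg c (g i) x := by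
  simp only [cellAvg]
  rw [sum_comm, sum_div]

/-- Averaging over cells is invisible to weights that are constant on cells. -/
lemma sum_mul_cellAvg (c : V → K) (g w : V → ℝ) (hw : ∀ x x', c x = c x' → w x = w x') :
    ∑ x, w x * cellAvg c g x = ∑ x, w x * g x := by
  have h1 : ∀ x, w x * cellAvg c g x =
      ∑ x', if c x' = c x then w x' * g x' / cellCard c x' else 0 := by
    intro x
    rw [cellAvg, mul_div_assoc', mul_sum, sum_div, sum_filter]
    refine sum_congr rfl fun x' _ => ?_
    split_ifs with h
    · rw [hw _ _ h, cellCard_congr h]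
    · rfl
  simp_rw [h1]
  rw [sum_comm]
  refine sum_congr rfl fun x' _ => ?_
  rw [← sum_filter, sum_const, nsmul_eq_mul]
  have h2 : (Finset.univ.filter fun x => c x' = c x) = Finset.univ.filter fun x => c x = c x' := by
    ext; simp [eq_comm]
  rw [h2]
  change cellCard c x' * _ = _
  rw [mul_div_cancel₀ _ (cellCard_pos c x').ne']

lemma sum_cellAvg (c : V → K) (g : V → ℝ) : ∑ x, cellAvg c g x = ∑ x, g x := by
  simpa using sum_mul_cellAvg c g (fun _ => 1) (fun _ _ _ => rfl)

lemma eq_zero_of_cellAvg_eq_zero {c : V → K} {g : V → ℝ} (hg : ∀ x, 0 ≤ g x) {x x' : V}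
    (h : cellAvg c g x = 0) (hx : c x' = c x) : g x' = 0 := by
  rw [cellAvg, div_eq_zero_iff] at h
  have h := h.resolve_right (cellCard_pos c x).ne'
  exact (sum_eq_zero_iff_of_nonneg fun _ _ => hg _).1 h x' (by simpa using hx)

lemma cellAvg_eq_zero {c : V → K} {g : V → ℝ} {x : V} (h : ∀ x', c x' = c x → g x' = 0) :
    cellAvg c g x = 0 := by
  rw [cellAvg, sum_eq_zero, zero_div]
  intro x' hx'
  exact h x' (by simpa using hx')

lemma cellAvg_le_inv {c : V → K} {P : V → Prop} {x : V}
    (h : ∀ u v, c u = c x → c v = c x → P u → P v → u = v) :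
    cellAvg c (fun x => ind (P x)) x ≤ 1 / cellCard c x := by
  rw [cellAvg]
  refine div_le_div_of_nonneg_right ?_ (cellCard_pos c x).le
  unfold ind
  rw [← sum_filter, filter_filter, sum_const, nsmul_eq_mul, mul_one]
  norm_cast
  rw [card_le_one]
  intro u hu v hv
  simp only [mem_filter, mem_univ, true_and] at hu hv
  exact h u v hu.1 hv.1 hu.2 hv.2

/-- The second order term in the convexity inequality for `t ↦ t * log t`. -/
lemma mul_log_gap {p q : ℝ} (hp : 0 < p) (hq : 0 ≤ q) :
    p * Real.log p + (Real.log p + 1) * (q - p) + (1 / 8) * (ind (q ≤ p / 2) * p) ≤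
      q * Real.log q := by
  rcases hq.eq_or_lt with rfl | hq
  · have := ind_le_one ((0 : ℝ) ≤ p / 2)
    simp only [zero_mul]
    nlinarith
  have key : ∀ r : ℝ, 0 < r → q * Real.log r + q - r ≤ q * Real.log q := by
    intro r hr
    have := Real.log_le_sub_one_of_pos (div_pos hr hq)
    rw [Real.log_div hr.ne' hq.ne'] at this
    have h2 := mul_le_mul_of_nonneg_left this hq.le
    have h3 : q * (r / q - 1) = r - q := by field_simp
    nlinarith
  by_cases h : q ≤ p / 2
  · rw [ind_of h]
    -- The tangent at `p / 2` beats the tangent at `p` here; the margin `1 / 8` fits because `log 2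
    -- / 2 < 3 / 8`.
    have h1 := key (p / 2) (by linarith)
    rw [Real.log_div hp.ne' two_ne_zero] at h1
    have := Real.log_two_lt_d9
    nlinarith
  · rw [ind_of_not h]
    have h1 := key p hp
    nlinarith

/-- Refining a partition increases the entropy by a definite amount wherever an average drops
by a factor of two. -/
lemma sum_mul_log_gap {c : V → K} {c' : V → K'} (hc : ∀ x x', c' x = c' x' → c x = c x')
    {g : V → ℝ} (hg : ∀ x, 0 ≤ g x) :
    ∑ x, cellAvg c g x * Real.log (cellAvg c g x) +
      (1 / 8) * ∑ x, (ind (cellAvg c' g x ≤ cellAvg c g x / 2) * cellAvg c g x) ≤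
    ∑ x, cellAvg c' g x * Real.log (cellAvg c' g x) := by
  -- The first-order term vanishes: its coefficient is constant on the coarse cells, hence on the
  -- fine ones, and both averages have the same integral against it.
  have h0 : ∑ x, (Real.log (cellAvg c g x) + 1) * (cellAvg c' g x - cellAvg c g x) = 0 := by
    simp_rw [mul_sub]
    rw [sum_sub_distrib, sum_mul_cellAvg, sum_mul_cellAvg, sub_self]
    · intro x x' h
      rw [cellAvg_congr h]
    · intro x x' h
      rw [cellAvg_congr (hc _ _ h)]
  have h1 := sum_le_sum fun x (_ : x ∈ univ) =>
    show cellAvg c g x * Real.log (cellAvg c g x) +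
        (Real.log (cellAvg c g x) + 1) * (cellAvg c' g x - cellAvg c g x) +
        (1 / 8) * (ind (cellAvg c' g x ≤ cellAvg c g x / 2) * cellAvg c g x) ≤
        cellAvg c' g x * Real.log (cellAvg c' g x) by
      rcases (cellAvg_nonneg (c := c) hg x).eq_or_lt with h | h
      · have : cellAvg c' g x = 0 :=
          cellAvg_eq_zero fun x' hx' => eq_zero_of_cellAvg_eq_zero hg h.symm (hc _ _ hx')
        rw [this, ← h]
        simp
      · exact mul_log_gap h (cellAvg_nonneg hg x)
  rw [sum_add_distrib, sum_add_distrib, h0, add_zero, ← mul_sum] at h1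
  exact h1

/-- Few points lie in small cells. -/
lemma sum_small_cells (c : V → K) (t : Finset K) (hc : ∀ x, c x ∈ t) {m : ℝ} (hm : 0 ≤ m) :
    ∑ x, ind (cellCard c x < m) ≤ #t * m := by
  have h1 : ∀ x, ind (cellCard c x < m) = ∑ k ∈ t, ind (c x = k ∧ cellCard c x < m) := by
    intro x
    rw [sum_eq_single (c x)]
    · simp
    · exact fun k _ hk => ind_of_not fun h => hk h.1.symm
    · exact fun h => absurd (hc x) h
  simp_rw [h1]
  rw [sum_comm, ← nsmul_eq_mul]
  refine sum_le_card_nsmul _ _ _ fun k _ => ?_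
  by_cases h : ∃ x, c x = k ∧ cellCard c x < m
  · obtain ⟨x, rfl, hx⟩ := h
    refine le_trans ?_ hx.le
    rw [cellCard, ← mul_one (#{x' | c x' = c x} : ℝ), ← nsmul_eq_mul, ← sum_const, sum_filter]
    refine sum_le_sum fun u _ => ?_
    split_ifs with hu
    · exact ind_le_one _
    · rw [ind_of_not fun h => hu h.1]
  · push Not at h
    rw [sum_eq_zero fun x _ => ind_of_not fun h' => (h x h'.1).not_gt h'.2]
    exact hm

end CellAverage

end TriangleSystem

/-! ### Triangle systems, cell densities and entropy -/

/-- A tripartite family of edge-disjoint triangles whose union contains no further triangle. -/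
structure IsTriangleSystem {V : Type*} (T : V → V → V → Prop) : Prop where
  fst_unique : ∀ {x x' y z}, T x y z → T x' y z → x = x'
  snd_unique : ∀ {x y y' z}, T x y z → T x y' z → y = y'
  trd_unique : ∀ {x y z z'}, T x y z → T x y z' → z = z'
  closed : ∀ {x y z a b c}, T x y c → T a y z → T x b z → T x y z

namespace TriangleSystem

variable {V : Type*} {T : V → V → V → Prop}

/-- Adjacency between the first and the second class. -/
def EdgeXY (T : V → V → V → Prop) (x y : V) : Prop := ∃ z, T x y z

/-- Adjacency between the first and the third class. -/
def EdgeXZ (T : V → V → V → Prop) (x z : V) : Prop := ∃ y, T x y z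

/-- Adjacency between the second and the third class. -/
def EdgeYZ (T : V → V → V → Prop) (y z : V) : Prop := ∃ x, T x y z

/-- The set of vertices of `S` that are joined to `x`. -/
def trace (T : V → V → V → Prop) (S : Finset V) (x : V) : Finset V :=
  {z ∈ S | EdgeXZ T x z}

/-- Some vertex of `C` is joined to both `x` and `y`. -/
def Covered (T : V → V → V → Prop) (C : Finset V) (x y : V) : Prop :=
  ∃ z ∈ C, EdgeXZ T x z ∧ EdgeYZ T y z

lemma trace_eq_iff {S : Finset V} {x x' : V} :
    trace T S x = trace T S x' ↔ ∀ z ∈ S, EdgeXZ T x z ↔ EdgeXZ T x' z := by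
  simp only [trace, Finset.ext_iff, mem_filter]
  grind

lemma trace_refines {S S' : Finset V} (h : S ⊆ S') (x x' : V) :
    trace T S' x = trace T S' x' → trace T S x = trace T S x' := by
  simp only [trace_eq_iff]
  exact fun h' z hz => h' z (h hz)

lemma covered_congr {C S' : Finset V} (h : C ⊆ S') {x x' : V} (y : V)
    (hx : trace T S' x = trace T S' x') : Covered T C x y ↔ Covered T C x' y := by
  rw [trace_eq_iff] at hx
  exact exists_congr fun z => and_congr_right fun hz => and_congr_left fun _ => hx z (h hz)

variable [Fintype V]

/-- The density between the cell of `x` and the vertex `y` of the second class. -/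
def densY (T : V → V → V → Prop) (S : Finset V) (x y : V) : ℝ :=
  cellAvg (trace T S) (fun x => ind (EdgeXY T x y)) x

/-- The density between the cell of `x` and the vertex `z` of the third class. -/
def densZ (T : V → V → V → Prop) (S : Finset V) (x z : V) : ℝ :=
  cellAvg (trace T S) (fun x => ind (EdgeXZ T x z)) x

/-- The density of the triangles through `y` and `z` in the cell of `x`. -/
def densT (T : V → V → V → Prop) (S : Finset V) (x y z : V) : ℝ :=
  cellAvg (trace T S) (fun x => ind (T x y z)) x

/-- The number of triangles. -/
def count (T : V → V → V → Prop) : ℝ :=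
  ∑ x, ∑ y, ∑ z, ind (T x y z)

/-- The entropy of the partition into cells. -/
def entropy (T : V → V → V → Prop) (S : Finset V) : ℝ :=
  ∑ y, ∑ x, densY T S x y * Real.log (densY T S x y) +
    ∑ z, ∑ x, densZ T S x z * Real.log (densZ T S x z)

/-- The size of the cell of `x`. -/
def cellSize (T : V → V → V → Prop) (S : Finset V) (x : V) : ℝ :=
  cellCard (trace T S) x

/-- The weight of the pairs that are not covered by `C`. -/
def uncovered (T : V → V → V → Prop) (S C : Finset V) : ℝ :=
  ∑ x, ∑ y, ind (¬ Covered T C x y) * densY T S x y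

/-- The weight of the pairs whose density halves in the passage from `S` to `S'`. -/
def dropY (T : V → V → V → Prop) (S S' : Finset V) : ℝ :=
  ∑ x, ∑ y, ind (densY T S' x y ≤ densY T S x y / 2) * densY T S x y

/-- The weight of the pairs whose density halves in the passage from `S` to `S'`. -/
def dropZ (T : V → V → V → Prop) (S S' : Finset V) : ℝ :=
  ∑ x, ∑ z, ind (densZ T S' x z ≤ densZ T S x z / 2) * densZ T S x z

lemma densY_nonneg (S : Finset V) (x y : V) : 0 ≤ densY T S x y :=
  cellAvg_nonneg (fun _ => ind_nonneg _) _

lemma densZ_nonneg (S : Finset V) (x z : V) : 0 ≤ densZ T S x z :=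
  cellAvg_nonneg (fun _ => ind_nonneg _) _

lemma densT_nonneg (S : Finset V) (x y z : V) : 0 ≤ densT T S x y z :=
  cellAvg_nonneg (fun _ => ind_nonneg _) _

lemma densY_le_one (S : Finset V) (x y : V) : densY T S x y ≤ 1 :=
  cellAvg_le_one (fun _ => ind_le_one _) _

lemma densZ_le_one (S : Finset V) (x z : V) : densZ T S x z ≤ 1 :=
  cellAvg_le_one (fun _ => ind_le_one _) _

lemma cellSize_pos (S : Finset V) (x : V) : 0 < cellSize T S x :=
  cellCard_pos _ _

lemma sum_ind {p : V → Prop} (hp : ∀ a b, p a → p b → a = b) :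
    (∑ a, ind (p a)) = ind (∃ a, p a) := by
  by_cases h : ∃ a, p a
  · rw [ind_of h]
    obtain ⟨a, ha⟩ := h
    rw [sum_eq_single a]
    · exact ind_of ha
    · intro b _ hb
      exact ind_of_not fun h => hb (hp _ _ h ha)
    · simp
  · rw [ind_of_not h]
    exact sum_eq_zero fun a _ => ind_of_not fun ha => h ⟨a, ha⟩

lemma sum_densT_trd (hT : IsTriangleSystem T) (S : Finset V) (x y : V) :
    ∑ z, densT T S x y z = densY T S x y := by
  simp only [densT, densY]
  rw [← cellAvg_sum]
  congr 1
  ext x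
  exact sum_ind fun _ _ h h' => hT.trd_unique h h'

lemma sum_densT_snd (hT : IsTriangleSystem T) (S : Finset V) (x z : V) :
    ∑ y, densT T S x y z = densZ T S x z := by
  simp only [densT, densZ]
  rw [← cellAvg_sum]
  congr 1
  ext x
  exact sum_ind fun _ _ h h' => hT.snd_unique h h'

lemma sum_densT (S : Finset V) : ∑ x, ∑ y, ∑ z, densT T S x y z = count T := by
  simp only [count]
  rw [sum_comm, sum_comm (f := fun x y => ∑ z, ind (T x y z))]
  refine sum_congr rfl fun y _ => ?_
  rw [sum_comm, sum_comm (f := fun x z => ind (T x y z))]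
  exact sum_congr rfl fun z _ => sum_cellAvg _ _

lemma sum_densY (hT : IsTriangleSystem T) (S : Finset V) :
    ∑ x, ∑ y, densY T S x y = count T := by
  simp_rw [← sum_densT S, sum_densT_trd hT]

lemma sum_densZ (hT : IsTriangleSystem T) (S : Finset V) :
    ∑ x, ∑ z, densZ T S x z = count T := by
  simp_rw [← sum_densT S, ← sum_densT_snd hT]
  exact sum_congr rfl fun x _ => sum_comm

/-- The edge `yz` lies in at most one triangle, so at most one point of the cell counts. -/
lemma densT_le (hT : IsTriangleSystem T) (S : Finset V) (x y z : V) :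
    densT T S x y z ≤ 1 / cellSize T S x :=
  cellAvg_le_inv fun _ _ _ _ h h' => hT.fst_unique h h'

lemma edgeYZ_of_densT_ne_zero {S : Finset V} {x y z : V} (h : densT T S x y z ≠ 0) :
    EdgeYZ T y z := by
  by_contra hn
  exact h (cellAvg_eq_zero fun x' _ => ind_of_not fun h' => hn ⟨x', h'⟩)

lemma entropy_increment {S S' : Finset V} (h : S ⊆ S') :
    entropy T S + (1 / 8) * (dropY T S S' + dropZ T S S') ≤ entropy T S' := by
  have hY := sum_le_sum fun y (_ : y ∈ univ) => sum_mul_log_gap (trace_refines (T := T) h)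
    (g := fun x => ind (EdgeXY T x y)) fun _ => ind_nonneg _
  have hZ := sum_le_sum fun z (_ : z ∈ univ) => sum_mul_log_gap (trace_refines (T := T) h)
    (g := fun x => ind (EdgeXZ T x z)) fun _ => ind_nonneg _
  rw [sum_add_distrib, ← mul_sum] at hY hZ
  rw [dropY, sum_comm, dropZ, sum_comm (f := fun x z => _ * densZ T S x z)]
  simp only [entropy, densY, densZ]
  linarith

/-- Cells are indexed by subsets of `S`, so the small ones together hold at most `2 ^ #S * m`
points. -/
lemma sum_small_cellSize (S : Finset V) {m : ℝ} (hm : 0 ≤ m) (S' : Finset V) :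
    (∑ x, ∑ y, ind (cellSize T S x < m) * densY T S' x y) ≤ 2 ^ #S * m * Fintype.card V := by
  calc (∑ x, ∑ y, ind (cellSize T S x < m) * densY T S' x y)
      ≤ ∑ x, ind (cellSize T S x < m) * Fintype.card V := by
        refine sum_le_sum fun x _ => ?_
        rw [← mul_sum]
        refine mul_le_mul_of_nonneg_left ?_ (ind_nonneg _)
        exact (sum_le_card_nsmul _ _ 1 fun y _ => densY_le_one _ _ _).trans (by simp)
    _ = (∑ x, ind (cellSize T S x < m)) * Fintype.card V := by rw [sum_mul]
    _ ≤ _ := by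
        gcongr
        have := sum_small_cells (trace T S) S.powerset (fun x => by simp [trace]) hm
        rw [card_powerset] at this
        exact_mod_cast this

lemma sum_small {r : ℝ} (hr : 0 ≤ r) (f : V → V → ℝ) :
    (∑ x, ∑ y, ind (f x y < r) * f x y) ≤ r * Fintype.card V ^ 2 := by
  calc _ ≤ ∑ _x : V, ∑ _y : V, r := by
        refine sum_le_sum fun x _ => sum_le_sum fun y _ => ?_
        by_cases h : f x y < r
        · rw [ind_of h, one_mul]
          exact h.le
        · rw [ind_of_not h, zero_mul]
          exact hr
    _ = _ := by simp; ring

/-! ### Covering pairs and the entropy increment -/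

/-- The covered pairs lose most of their density. -/
lemma dropY_ge (hT : IsTriangleSystem T) (S C : Finset V) {r : ℝ} (hr : 0 < r) :
    count T - uncovered T S C - r * Fintype.card V ^ 2 -
      2 ^ #(S ∪ C) * (2 / r) * Fintype.card V ≤ dropY T S (S ∪ C) := by
  have h1 := sum_small hr.le (densY T S)
  have h2 := sum_small_cellSize (T := T) (S ∪ C) (m := 2 / r) (by positivity) S
  have key : ∑ x, ∑ y, (densY T S x y - ind (¬ Covered T C x y) * densY T S x y
      - ind (densY T S x y < r) * densY T S x y
      - ind (cellSize T (S ∪ C) x < 2 / r) * densY T S x y) ≤ dropY T S (S ∪ C) := by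
    refine sum_le_sum fun x _ => sum_le_sum fun y _ => ?_
    simp only [← one_sub_mul, ← sub_mul]
    refine mul_le_mul_of_nonneg_right ?_ (densY_nonneg _ _ _)
    have i1 := ind_nonneg (¬ Covered T C x y)
    have i2 := ind_nonneg (densY T S x y < r)
    have i3 := ind_nonneg (cellSize T (S ∪ C) x < 2 / r)
    have i4 := ind_nonneg (densY T (S ∪ C) x y ≤ densY T S x y / 2)
    by_cases hc : Covered T C x y
    swap
    · rw [ind_of hc]
      linarith
    by_cases hd : densY T S x y < r
    · rw [ind_of hd]
      linarith
    by_cases hs : cellSize T (S ∪ C) x < 2 / r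
    · rw [ind_of hs]
      linarith
    rw [ind_of (p := _ ≤ _)]
    · linarith
    push Not at hd hs
    obtain ⟨z, hz, hxz, a, ha⟩ := hc
    -- All of the refined cell is joined to `z`, so each neighbour of `y` in it forms a triangle on
    -- the edge `yz`; edge-disjointness leaves at most one.
    have hle : densY T (S ∪ C) x y ≤ 1 / cellSize T (S ∪ C) x := by
      refine cellAvg_le_inv fun u v hu hv hu' hv' => ?_
      have aux : ∀ w, trace T (S ∪ C) w = trace T (S ∪ C) x → EdgeXY T w y → T w y z := by
        intro w hw ⟨c, hc⟩
        obtain ⟨b', hb'⟩ := (trace_eq_iff.1 hw z (mem_union_right _ hz)).2 hxz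
        exact hT.closed hc ha hb'
      exact hT.fst_unique (aux u hu hu') (aux v hv hv')
    have h3 : 1 / cellSize T (S ∪ C) x ≤ 1 / (2 / r) :=
      one_div_le_one_div_of_le (by positivity) hs
    rw [one_div_div] at h3
    linarith
  simp only [sum_sub_distrib] at key
  rw [sum_densY hT] at key
  simp only [uncovered]
  linarith

lemma uncovered_sub (S C : Finset V) (z : V) :
    uncovered T S C - uncovered T S (insert z C) =
      ∑ x, ∑ y, ind (¬ Covered T C x y) * densY T S x y * ind (EdgeYZ T y z) *
        ind (EdgeXZ T x z) := by
  simp only [uncovered, ← sum_sub_distrib]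
  refine sum_congr rfl fun x _ => sum_congr rfl fun y _ => ?_
  have : Covered T (insert z C) x y ↔ (EdgeXZ T x z ∧ EdgeYZ T y z) ∨ Covered T C x y := by
    simp [Covered]
  by_cases h1 : Covered T C x y <;> by_cases h2 : EdgeXZ T x z <;>
    by_cases h3 : EdgeYZ T y z <;> simp [ind, this, h1, h2, h3]

/-- The remaining weight is constant in `x` on the cells of `S ∪ C`, so adjacency of `x` and `z` may
be replaced by its cell average. -/
lemma sum_uncovered_sub (S C : Finset V) :
    ∑ z, (uncovered T S C - uncovered T S (insert z C)) =
      ∑ x, ∑ y, ∑ z, ind (¬ Covered T C x y) * densY T S x y * ind (EdgeYZ T y z) *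
        densZ T (S ∪ C) x z := by
  have h1 : ∀ y z, (∑ x, ind (¬ Covered T C x y) * densY T S x y * ind (EdgeYZ T y z) *
        ind (EdgeXZ T x z)) = ∑ x, ind (¬ Covered T C x y) * densY T S x y *
        ind (EdgeYZ T y z) * densZ T (S ∪ C) x z := by
    intro y z
    refine (sum_mul_cellAvg (trace T (S ∪ C)) _ _ ?_).symm
    intro x x' h
    rw [covered_congr subset_union_right y h, show densY T S x y = densY T S x' y from
      cellAvg_congr (trace_refines subset_union_left _ _ h)]
  simp_rw [uncovered_sub]
  calc _ = ∑ z, ∑ y, ∑ x, ind (¬ Covered T C x y) * densY T S x y * ind (EdgeYZ T y z) *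
        ind (EdgeXZ T x z) := sum_congr rfl fun z _ => sum_comm
    _ = ∑ y, ∑ z, ∑ x, ind (¬ Covered T C x y) * densY T S x y * ind (EdgeYZ T y z) *
        densZ T (S ∪ C) x z := by
      rw [sum_comm]
      exact sum_congr rfl fun y _ => sum_congr rfl fun z _ => h1 y z
    _ = ∑ y, ∑ x, ∑ z, ind (¬ Covered T C x y) * densY T S x y * ind (EdgeYZ T y z) *
        densZ T (S ∪ C) x z := sum_congr rfl fun y _ => sum_comm
    _ = _ := sum_comm

lemma sum_mul_densT_trd (hT : IsTriangleSystem T) (S : Finset V) (w : V → V → ℝ) :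
    ∑ x, ∑ y, ∑ z, w x y * densT T S x y z = ∑ x, ∑ y, w x y * densY T S x y := by
  simp_rw [← mul_sum, sum_densT_trd hT]

lemma sum_mul_densT_snd (hT : IsTriangleSystem T) (S : Finset V) (w : V → V → ℝ) :
    ∑ x, ∑ y, ∑ z, w x z * densT T S x y z = ∑ x, ∑ z, w x z * densZ T S x z := by
  simp_rw [← sum_densT_snd hT, mul_sum]
  exact sum_congr rfl fun x _ => sum_comm

/-- Lower bound for the total weight that single vertices cover. -/
lemma sum_uncovered_sub_ge (hT : IsTriangleSystem T) (S C : Finset V) {r m : ℝ} (hr : 0 < r)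
    (hm : 0 < m) :
    r ^ 2 / 2 * m * (uncovered T S C - dropZ T S (S ∪ C) - 2 * r * Fintype.card V ^ 2 -
      2 ^ #S * m * Fintype.card V) ≤
      ∑ z, (uncovered T S C - uncovered T S (insert z C)) := by
  rw [sum_uncovered_sub]
  have key : ∑ x, ∑ y, ∑ z, r ^ 2 / 2 * m *
      (ind (¬ Covered T C x y) * densT T S x y z
        - ind (densZ T (S ∪ C) x z ≤ densZ T S x z / 2) * densT T S x y z
        - ind (densY T S x y < r) * densT T S x y z
        - ind (densZ T S x z < r) * densT T S x y z
        - ind (cellSize T S x < m) * densT T S x y z) ≤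
      ∑ x, ∑ y, ∑ z, ind (¬ Covered T C x y) * densY T S x y * ind (EdgeYZ T y z) *
        densZ T (S ∪ C) x z := by
    refine sum_le_sum fun x _ => sum_le_sum fun y _ => sum_le_sum fun z _ => ?_
    have hY := densY_nonneg (T := T) S x y
    have hZ := densZ_nonneg (T := T) (S ∪ C) x z
    have hR : 0 ≤ ind (¬ Covered T C x y) * densY T S x y * ind (EdgeYZ T y z) *
        densZ T (S ∪ C) x z :=
      mul_nonneg (mul_nonneg (mul_nonneg (ind_nonneg _) hY) (ind_nonneg _)) hZ
    simp only [← sub_mul]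
    by_cases ht : densT T S x y z = 0
    · simpa [ht] using hR
    have ht0 := densT_nonneg (T := T) S x y z
    have i1 := ind_nonneg (densZ T (S ∪ C) x z ≤ densZ T S x z / 2)
    have i2 := ind_nonneg (densY T S x y < r)
    have i3 := ind_nonneg (densZ T S x z < r)
    have i4 := ind_nonneg (cellSize T S x < m)
    have i5 := ind_le_one (¬ Covered T C x y)
    by_cases hgood : ¬ Covered T C x y ∧ densZ T S x z / 2 < densZ T (S ∪ C) x z ∧
        r ≤ densY T S x y ∧ r ≤ densZ T S x z ∧ m ≤ cellSize T S x
    · obtain ⟨g1, g2, g3, g4, g5⟩ := hgood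
      rw [ind_of g1, ind_of (edgeYZ_of_densT_ne_zero ht), ind_of_not g2.not_ge,
        ind_of_not g3.not_gt, ind_of_not g4.not_gt, ind_of_not g5.not_gt]
      -- In a cell of size at least `m` a single triangle has density at most `1 / m`. This bounds
      -- triangle mass, whose total is known, by the product of the two edge densities, which is at
      -- least `r ^ 2 / 2`.
      have h1 : m * densT T S x y z ≤ 1 := by
        have h2 := densT_le hT S x y z
        rw [le_div_iff₀ (cellSize_pos S x)] at h2
        nlinarith
      calc _ = r ^ 2 / 2 * (m * densT T S x y z) := by ring
        _ ≤ r ^ 2 / 2 * 1 := by gcongr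
        _ = r * (r / 2) := by ring
        _ ≤ densY T S x y * densZ T (S ∪ C) x z := by
          gcongr
          linarith
        _ = _ := by ring
    · refine le_trans (mul_nonpos_of_nonneg_of_nonpos (by positivity)
        (mul_nonpos_of_nonpos_of_nonneg ?_ ht0)) hR
      rw [not_and_or, not_and_or, not_and_or, not_and_or] at hgood
      rcases hgood with h | h | h | h | h
      · rw [ind_of_not h]
        linarith
      · rw [ind_of (not_lt.1 h)]
        linarith
      · rw [ind_of (not_le.1 h)]
        linarith
      · rw [ind_of (not_le.1 h)]
        linarith
      · rw [ind_of (not_le.1 h)]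
        linarith
  refine le_trans ?_ key
  simp_rw [← mul_sum]
  refine mul_le_mul_of_nonneg_left ?_ (by positivity)
  simp only [sum_sub_distrib]
  rw [sum_mul_densT_trd hT S fun x y => ind (¬ Covered T C x y),
    sum_mul_densT_trd hT S fun x y => ind (densY T S x y < r),
    sum_mul_densT_trd hT S fun x _ => ind (cellSize T S x < m),
    sum_mul_densT_snd hT S fun x z => ind (densZ T (S ∪ C) x z ≤ densZ T S x z / 2),
    sum_mul_densT_snd hT S fun x z => ind (densZ T S x z < r)]
  have h1 := sum_small hr.le (densY T S)
  have h2 := sum_small hr.le (densZ T S)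
  have h3 := sum_small_cellSize (T := T) S hm.le S
  simp only [uncovered, dropZ]
  linarith

/-- As long as a good part of the weight is uncovered, a single vertex covers some of it. -/
lemma exists_uncovered_insert_le (hT : IsTriangleSystem T) {d : ℝ} (hd : 0 < d)
    (hV : 0 < Fintype.card V) (S C : Finset V)
    (hZ : dropZ T S (S ∪ C) ≤ d * Fintype.card V ^ 2 / 8)
    (hW : 3 / 4 * (d * Fintype.card V ^ 2) ≤ uncovered T S C) :
    ∃ z, uncovered T S (insert z C) ≤
      uncovered T S C - d ^ 3 / 2 ^ (#S + 17) * (d * Fintype.card V ^ 2) := by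
  by_contra! hcon
  set n : ℝ := (Fintype.card V : ℝ) with hn
  have hn0 : 0 < n := Nat.cast_pos.2 hV
  -- In units of `d * n ^ 2` the losses are `1/8` from `dropZ`, `2/32` from low densities and `1/32`
  -- from small cells, leaving at least `1/2` of the initial `3/4`.
  have h1 := sum_uncovered_sub_ge hT S C (r := d / 32) (m := d * n / (32 * 2 ^ #S))
    (by positivity) (by positivity)
  rw [← hn] at h1
  have : Nonempty V := Fintype.card_pos_iff.1 hV
  have h2 : ∑ z, (uncovered T S C - uncovered T S (insert z C)) <
      ∑ _z : V, d ^ 3 / 2 ^ (#S + 17) * (d * n ^ 2) :=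
    sum_lt_sum_of_nonempty univ_nonempty fun z _ => by linarith [hcon z]
  rw [sum_const, card_univ, nsmul_eq_mul, ← hn] at h2
  have h3 : 2 ^ #S * (d * n / (32 * 2 ^ #S)) * n = d * n ^ 2 / 32 := by
    field_simp
  rw [h3] at h1
  have h4 : d * n ^ 2 / 2 ≤ uncovered T S C - dropZ T S (S ∪ C) - 2 * (d / 32) * n ^ 2 -
      d * n ^ 2 / 32 := by
    have : 0 ≤ d * n ^ 2 := by positivity
    linarith
  have h5 := mul_le_mul_of_nonneg_left h4
    (show 0 ≤ (d / 32) ^ 2 / 2 * (d * n / (32 * 2 ^ #S)) by positivity)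
  have h6 : (d / 32) ^ 2 / 2 * (d * n / (32 * 2 ^ #S)) * (d * n ^ 2 / 2) =
      n * (d ^ 3 / 2 ^ (#S + 17) * (d * n ^ 2)) := by
    rw [pow_add]
    field_simp
    norm_num
  linarith

/-- Every partition into cells has a refinement of bounded complexity with larger entropy. -/
lemma exists_entropy_increment (hT : IsTriangleSystem T) {d : ℝ} (hd : 0 < d)
    (hV : 0 < Fintype.card V) (hcount : count T = d * Fintype.card V ^ 2) (S : Finset V) (s : ℕ)
    (hs : 2 ^ (#S + 17) ≤ s * d ^ 3)
    (hn : 2 ^ (#S + s) * 2048 ≤ d ^ 2 * Fintype.card V) :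
    ∃ S' : Finset V, #S' ≤ #S + s ∧
      entropy T S + d * Fintype.card V ^ 2 / 64 ≤ entropy T S' := by
  by_contra! hcon
  set n : ℝ := (Fintype.card V : ℝ) with hn'
  have hn0 : 0 < n := Nat.cast_pos.2 hV
  have hD : 0 < d * n ^ 2 := by positivity
  have hcard : ∀ C : Finset V, #C ≤ s → #(S ∪ C) ≤ #S + s := fun C hC =>
    (card_union_le _ _).trans (by omega)
  have hdrop : ∀ C : Finset V, #C ≤ s →
      dropY T S (S ∪ C) + dropZ T S (S ∪ C) < d * n ^ 2 / 8 := by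
    intro C hC
    have h1 := hcon (S ∪ C) (hcard C hC)
    have h2 := entropy_increment (T := T) (S := S) (S' := S ∪ C) subset_union_left
    linarith
  have hYnn : ∀ S', 0 ≤ dropY T S S' := fun S' => sum_nonneg fun x _ => sum_nonneg fun y _ =>
    mul_nonneg (ind_nonneg _) (densY_nonneg _ _ _)
  have hZnn : ∀ S', 0 ≤ dropZ T S S' := fun S' => sum_nonneg fun x _ => sum_nonneg fun y _ =>
    mul_nonneg (ind_nonneg _) (densZ_nonneg _ _ _)
  -- Covering more than a quarter would make `dropY` exceed `1/4 - 1/32 - 1/32 = 3/16` of the total,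
  -- above the `1/8` allowed without an increment.
  have hW : ∀ C : Finset V, #C ≤ s → 3 / 4 * (d * n ^ 2) ≤ uncovered T S C := by
    intro C hC
    by_contra! hlt
    have h1 := dropY_ge hT S C (r := d / 32) (by positivity)
    rw [← hn', hcount] at h1
    have h2 := hdrop C hC
    have h3 : (2 : ℝ) ^ #(S ∪ C) * (2 / (d / 32)) * n ≤ d * n ^ 2 / 32 := by
      have h4 : (2 : ℝ) ^ #(S ∪ C) ≤ 2 ^ (#S + s) :=
        pow_le_pow_right₀ one_le_two (hcard C hC)
      have h5 : (2 : ℝ) ^ #(S ∪ C) * 2048 ≤ d ^ 2 * n := by linarith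
      have h6 : (2 : ℝ) ^ #(S ∪ C) * (2 / (d / 32)) * n =
          (2 : ℝ) ^ #(S ∪ C) * 2048 * (n / (32 * d)) := by
        field_simp
        norm_num
      rw [h6]
      refine (mul_le_mul_of_nonneg_right h5 (by positivity)).trans_eq ?_
      field_simp
    linarith [hZnn (S ∪ C)]
  -- Greedy covering: every step gains a fixed amount, so after `s` steps nothing would be left
  -- uncovered, against `hW`.
  have hchain : ∀ j ≤ s, ∃ C : Finset V, #C ≤ j ∧
      uncovered T S C ≤ (1 - j * (d ^ 3 / 2 ^ (#S + 17))) * (d * n ^ 2) := by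
    intro j
    induction j with
    | zero =>
      refine fun _ => ⟨∅, by simp, ?_⟩
      rw [Nat.cast_zero, zero_mul, sub_zero, one_mul, ← hcount, ← sum_densY hT S]
      refine sum_le_sum fun x _ => sum_le_sum fun y _ => ?_
      exact mul_le_of_le_one_left (densY_nonneg _ _ _) (ind_le_one _)
    | succ j ih =>
      intro hj
      obtain ⟨C, hC, hle⟩ := ih (by omega)
      obtain ⟨z, hz⟩ := exists_uncovered_insert_le hT hd hV S C
        (by linarith [hdrop C (by omega), hYnn (S ∪ C)]) (hW C (by omega))
      refine ⟨insert z C, (card_insert_le _ _).trans (by omega), hz.trans ?_⟩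
      rw [← hn']
      push_cast
      linarith
  obtain ⟨C, hC, hle⟩ := hchain s le_rfl
  have h1 := hW C hC
  have h2 : 1 ≤ s * (d ^ 3 / 2 ^ (#S + 17)) := by
    rw [mul_div_assoc', le_div_iff₀ (by positivity)]
    linarith
  nlinarith

/-! ### Range of the entropy and iterated refinement -/

lemma entropy_nonpos (S : Finset V) : entropy T S ≤ 0 := by
  refine add_nonpos (sum_nonpos fun y _ => sum_nonpos fun x _ => ?_)
    (sum_nonpos fun z _ => sum_nonpos fun x _ => ?_)
  · exact mul_nonpos_of_nonneg_of_nonpos (densY_nonneg _ _ _)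
      (Real.log_nonpos (densY_nonneg _ _ _) (densY_le_one _ _ _))
  · exact mul_nonpos_of_nonneg_of_nonpos (densZ_nonneg _ _ _)
      (Real.log_nonpos (densZ_nonneg _ _ _) (densZ_le_one _ _ _))

/-- Jensen's inequality for `t * log t`, through the tangent at the mean `d`. -/
lemma sum_mul_log_ge {d : ℝ} (hd : 0 < d) {f : V → V → ℝ} (hf : ∀ x y, 0 ≤ f x y)
    (h : ∑ x, ∑ y, f x y = d * Fintype.card V ^ 2) :
    d * Fintype.card V ^ 2 * Real.log d ≤ ∑ x, ∑ y, f x y * Real.log (f x y) := by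
  have h1 : ∑ x, ∑ y, (d * Real.log d + (Real.log d + 1) * (f x y - d)) ≤
      ∑ x, ∑ y, f x y * Real.log (f x y) := by
    refine sum_le_sum fun x _ => sum_le_sum fun y _ => ?_
    have h2 := mul_log_gap hd (hf x y)
    have h3 := mul_nonneg (ind_nonneg (f x y ≤ d / 2)) hd.le
    linarith
  refine le_trans (le_of_eq ?_) h1
  simp only [sum_add_distrib, ← mul_sum, sum_sub_distrib, h]
  simp
  ring

lemma entropy_ge (hT : IsTriangleSystem T) {d : ℝ} (hd : 0 < d)
    (hcount : count T = d * Fintype.card V ^ 2) (S : Finset V) :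
    2 * (d * Fintype.card V ^ 2 * Real.log d) ≤ entropy T S := by
  have h1 := sum_mul_log_ge hd (densY_nonneg (T := T) S) ((sum_densY hT S).trans hcount)
  have h2 := sum_mul_log_ge hd (densZ_nonneg (T := T) S) ((sum_densZ hT S).trans hcount)
  rw [entropy, sum_comm, sum_comm (f := fun z x => densZ T S x z * _)]
  linarith

/-- The numbers of cell-defining vertices in the iterated refinement. -/
def refinementSize (k : ℕ) : ℕ → ℕ
  | 0 => 0
  | j + 1 => refinementSize k j + 2 ^ (refinementSize k j + 17 + 3 * k)

lemma refinementSize_mono (k : ℕ) : Monotone (refinementSize k) :=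
  monotone_nat_of_le_succ fun _ => Nat.le_add_right _ _

lemma exists_entropy_ge (hT : IsTriangleSystem T) {d : ℝ} (hd : 0 < d)
    (hV : 0 < Fintype.card V) (hcount : count T = d * Fintype.card V ^ 2) {k : ℕ}
    (hk : 1 ≤ d * 2 ^ k) (j : ℕ)
    (hn : 2 ^ (refinementSize k j + 11 + 2 * k) ≤ Fintype.card V) :
    ∃ S : Finset V, #S ≤ refinementSize k j ∧
      entropy T ∅ + j * (d * Fintype.card V ^ 2 / 64) ≤ entropy T S := by
  induction j with
  | zero => exact ⟨∅, by simp, by simp⟩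
  | succ j ih =>
    have hmono := refinementSize_mono k (Nat.le_add_right j 1)
    obtain ⟨S, hS, hle⟩ := ih ((Nat.pow_le_pow_right two_pos (by omega)).trans hn)
    -- Since `d ≥ 2 ^ (-k)`, the summand `3 * k` in the exponent pays for `d ^ 3`; in the bound on
    -- the number of vertices, `2 * k` pays for `d ^ 2` and `11` for `2048`.
    obtain ⟨S', hS', hle'⟩ := exists_entropy_increment hT hd hV hcount S
      (2 ^ (refinementSize k j + 17 + 3 * k)) (by
        push_cast
        have h1 : (2 : ℝ) ^ (#S + 17) ≤ 2 ^ (refinementSize k j + 17) :=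
          pow_le_pow_right₀ one_le_two (by omega)
        have h2 : (1 : ℝ) ≤ (d * 2 ^ k) ^ 3 := one_le_pow₀ hk
        calc (2 : ℝ) ^ (#S + 17) ≤ 2 ^ (refinementSize k j + 17) * 1 := by linarith
          _ ≤ 2 ^ (refinementSize k j + 17) * (d * 2 ^ k) ^ 3 := by gcongr
          _ = _ := by rw [pow_add _ _ (3 * k), pow_mul']; ring) (by
        have h1 : (2 : ℝ) ^ (#S + 2 ^ (refinementSize k j + 17 + 3 * k)) ≤
            2 ^ refinementSize k (j + 1) :=
          pow_le_pow_right₀ one_le_two (by rw [refinementSize]; omega)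
        have h2 : (1 : ℝ) ≤ (d * 2 ^ k) ^ 2 := one_le_pow₀ hk
        have h3 : (2 : ℝ) ^ (refinementSize k (j + 1) + 11 + 2 * k) ≤ Fintype.card V := by
          exact_mod_cast hn
        calc (2 : ℝ) ^ (#S + 2 ^ (refinementSize k j + 17 + 3 * k)) * 2048
            ≤ 2 ^ refinementSize k (j + 1) * 2048 * 1 := by linarith
          _ ≤ 2 ^ refinementSize k (j + 1) * 2048 * (d * 2 ^ k) ^ 2 := by gcongr
          _ = d ^ 2 * 2 ^ (refinementSize k (j + 1) + 11 + 2 * k) := by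
            rw [pow_add _ _ (2 * k), pow_mul', pow_add]; norm_num; ring
          _ ≤ _ := by gcongr)
    refine ⟨S', hS'.trans (by rw [refinementSize]; omega), ?_⟩
    push_cast
    linarith

/-- A dense triangle system has a bounded number of vertices. -/
lemma card_lt (hT : IsTriangleSystem T) {d : ℝ} (hd : 0 < d)
    (hcount : count T = d * Fintype.card V ^ 2) {k : ℕ} (hk : 1 ≤ d * 2 ^ k) :
    Fintype.card V < 2 ^ (refinementSize k (128 * k + 1) + 11 + 2 * k) := by
  by_contra! hn
  have hV : 0 < Fintype.card V := lt_of_lt_of_le (by positivity) hn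
  -- The entropy range is at most `2 * k * d * n ^ 2` and each round gains `d * n ^ 2 / 64`, so one
  -- round more than `128 * k` is impossible.
  obtain ⟨S, -, hle⟩ := exists_entropy_ge hT hd hV hcount hk (128 * k + 1) hn
  have h1 := entropy_ge hT hd hcount ∅
  have h2 := entropy_nonpos (T := T) S
  have hn0 : (0 : ℝ) < Fintype.card V := by exact_mod_cast hV
  have hD : 0 < d * (Fintype.card V : ℝ) ^ 2 := by positivity
  have hlog : -(k : ℝ) ≤ Real.log d := by
    have h3 := Real.log_nonneg hk
    rw [Real.log_mul hd.ne' (by positivity), Real.log_pow] at h3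
    have h4 := mul_le_mul_of_nonneg_left Real.log_two_lt_d9.le (Nat.cast_nonneg (α := ℝ) k)
    have h5 := Nat.cast_nonneg (α := ℝ) k
    linarith
  have h3 := mul_le_mul_of_nonneg_left hlog hD.le
  push_cast at hle
  nlinarith

lemma count_le (hT : IsTriangleSystem T) : count T ≤ Fintype.card V ^ 2 := by
  rw [← sum_densY hT ∅]
  refine (sum_le_sum fun x _ => sum_le_sum fun y _ => densY_le_one ∅ x y).trans (le_of_eq ?_)
  simp
  ring

/-- Edge-disjoint triangles without further triangles cannot cover nearly all pairs. -/
lemma density_le (hT : IsTriangleSystem T) {d : ℝ} (hd : 0 < d)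
    (hcount : count T = d * Fintype.card V ^ 2) (hV : 2 ≤ Fintype.card V) : d ≤ 4 / 5 := by
  set n : ℝ := (Fintype.card V : ℝ) with hn
  have hn2 : (2 : ℝ) ≤ n := Nat.ofNat_le_cast.2 hV
  have hxy : ∑ x, ∑ y, ind (EdgeXY T x y) = d * n ^ 2 := by
    rw [← hcount, count]
    exact sum_congr rfl fun x _ => sum_congr rfl fun y _ =>
      (sum_ind fun _ _ h h' => hT.trd_unique h h').symm
  have hx : ∀ z, ∑ x, ind (EdgeXZ T x z) = ∑ x, ∑ y, ind (T x y z) := fun z =>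
    sum_congr rfl fun x _ => (sum_ind fun _ _ h h' => hT.snd_unique h h').symm
  have hy : ∀ z, ∑ y, ind (EdgeYZ T y z) = ∑ x, ∑ y, ind (T x y z) := fun z => by
    rw [sum_comm]
    exact sum_congr rfl fun x _ => (sum_ind fun _ _ h h' => hT.fst_unique h h').symm
  have hz : ∑ z, ∑ x, ∑ y, ind (T x y z) = d * n ^ 2 := by
    rw [← hcount, count, sum_comm]
    exact sum_congr rfl fun x _ => sum_comm
  -- With `t` triangles at `z`, there are `t` neighbours on either side. The `t ^ 2` pairs they form
  -- meet the `d * n ^ 2` edges only in the `t` triangles at `z`.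
  have hloc : ∀ z, d * n ^ 2 + (∑ x, ∑ y, ind (T x y z)) ^ 2 ≤
      n ^ 2 + ∑ x, ∑ y, ind (T x y z) := by
    intro z
    have h1 : ∑ x, ∑ y, (ind (EdgeXY T x y) + ind (EdgeXZ T x z) * ind (EdgeYZ T y z)) ≤
        ∑ x, ∑ y, (1 + ind (T x y z)) := by
      refine sum_le_sum fun x _ => sum_le_sum fun y _ => ?_
      have i1 := ind_le_one (EdgeXY T x y)
      have i2 := ind_nonneg (T x y z)
      by_cases h2 : EdgeXZ T x z
      swap
      · rw [ind_of_not h2]; linarith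
      by_cases h3 : EdgeYZ T y z
      swap
      · rw [ind_of_not h3]; linarith
      by_cases h1 : EdgeXY T x y
      swap
      · rw [ind_of_not h1, ind_of h2, ind_of h3]; linarith
      obtain ⟨c, h1⟩ := h1
      obtain ⟨b, h2⟩ := h2
      obtain ⟨a, h3⟩ := h3
      rw [ind_of (hT.closed h1 h3 h2), ind_of (show EdgeXZ T x z from ⟨b, h2⟩),
        ind_of (show EdgeYZ T y z from ⟨a, h3⟩), ind_of (show EdgeXY T x y from ⟨c, h1⟩)]
      norm_num
    simp only [sum_add_distrib, ← mul_sum, ← sum_mul] at h1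
    rw [hxy, hx, hy] at h1
    simp only [sum_const, card_univ, nsmul_eq_mul, mul_one, ← hn] at h1
    linarith
  have h1 := sum_le_sum fun z (_ : z ∈ univ) => hloc z
  simp only [sum_add_distrib, sum_const, card_univ, nsmul_eq_mul, ← hn] at h1
  rw [hz] at h1
  have h2 := sq_sum_le_card_mul_sum_sq (s := univ) (f := fun z => ∑ x, ∑ y, ind (T x y z))
  rw [hz, card_univ, ← hn] at h2
  have h3 : d ^ 2 * n ^ 3 ≤ ∑ z, (∑ x, ∑ y, ind (T x y z)) ^ 2 := by
    have : n * (d ^ 2 * n ^ 3) ≤ n * ∑ z, (∑ x, ∑ y, ind (T x y z)) ^ 2 := by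
      linarith [show n * (d ^ 2 * n ^ 3) = (d * n ^ 2) ^ 2 by ring]
    exact le_of_mul_le_mul_left this (by linarith)
  have h4 : n ^ 2 * (d * n + d ^ 2 * n) ≤ n ^ 2 * (n + d) := by linarith
  have h5 := le_of_mul_le_mul_left h4 (by positivity)
  by_contra! hcon
  nlinarith [mul_pos (sub_pos.2 hcon) hd]

end TriangleSystem

/-! ### Towers, the iterated logarithm and the final density bound -/

/-- The tower function. -/
def tower : ℕ → ℕ
  | 0 => 1
  | k + 1 => 2 ^ tower k

/-- The quantifier over `i ≤ k` is needed: `Real.logb` of a negative number is the logarithm of its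
absolute value, so iterates can exceed `1` again after having dropped below it. -/
lemma exists_iterate_logb_le_one_iff (k : ℕ) (x : ℝ) :
    (∃ i ≤ k, (Real.logb 2)^[i] x ≤ 1) ↔ x ≤ tower k := by
  induction k generalizing x with
  | zero => simp [tower]
  | succ k ih =>
    have hsplit : (∃ i ≤ k + 1, (Real.logb 2)^[i] x ≤ 1) ↔
        x ≤ 1 ∨ ∃ i ≤ k, (Real.logb 2)^[i] (Real.logb 2 x) ≤ 1 := by
      constructor
      · rintro ⟨_ | i, hi, h⟩
        · exact Or.inl h
        · exact Or.inr ⟨i, by omega, h⟩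
      · rintro (h | ⟨i, hi, h⟩)
        · exact ⟨0, by omega, h⟩
        · exact ⟨i + 1, by omega, h⟩
    rw [hsplit, ih]
    rcases le_or_gt x 1 with hx | hx
    · have : (1 : ℝ) ≤ tower (k + 1) := by
        exact_mod_cast Nat.one_le_two_pow
      exact iff_of_true (Or.inl hx) (hx.trans this)
    · rw [or_iff_right hx.not_ge, Real.logb_le_iff_le_rpow one_lt_two (by linarith),
        Real.rpow_natCast, tower]
      push_cast
      rfl

lemma logStar_le_iff (k : ℕ) (x : ℝ) : logStar x ≤ k ↔ x ≤ tower k := by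
  rw [← exists_iterate_logb_le_one_iff]
  exact ⟨fun h => ⟨_, h, (isLeast_logStar x).1⟩,
    fun ⟨i, hi, h⟩ => ((isLeast_logStar x).2 h).trans hi⟩

lemma tendsto_logStar_natCast :
    Filter.Tendsto (fun N : ℕ => logStar (N : ℝ)) Filter.atTop Filter.atTop := by
  rw [Filter.tendsto_atTop]
  intro k
  filter_upwards [Filter.eventually_gt_atTop (tower k)] with N hN
  by_contra! h
  have h1 := (logStar_le_iff k N).1 h.le
  exact hN.not_ge (by exact_mod_cast h1)

namespace TriangleSystem

lemma le_tower (k : ℕ) : 17 + 3 * k ≤ tower (k + 4) := by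
  induction k with
  | zero => norm_num [tower]
  | succ k ih =>
    have h1 : tower (k + 1 + 4) = 2 ^ tower (k + 4) := rfl
    have h2 : tower (k + 4) + 1 ≤ 2 ^ tower (k + 4) := Nat.lt_two_pow_self
    have h3 : 2 * tower (k + 4) ≤ 2 ^ tower (k + 4) := by
      obtain ⟨m, hm⟩ := Nat.exists_eq_add_of_le' (show 1 ≤ tower (k + 4) by omega)
      have : m + 1 ≤ 2 ^ m := Nat.lt_two_pow_self
      rw [hm, pow_succ]
      omega
    omega

/-- With the offset included, a round is `t ↦ t + 2 ^ t ≤ 2 ^ 2 ^ t`, which costs two levels of the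
tower. -/
lemma refinementSize_le_tower (k j : ℕ) :
    refinementSize k j + 17 + 3 * k ≤ tower (k + 4 + 2 * j) := by
  induction j with
  | zero => simpa [refinementSize] using le_tower k
  | succ j ih =>
    have h1 : tower (k + 4 + 2 * (j + 1)) = 2 ^ 2 ^ tower (k + 4 + 2 * j) := rfl
    set t := refinementSize k j + 17 + 3 * k with ht
    have h2 : t + 1 ≤ 2 ^ t := Nat.lt_two_pow_self
    calc refinementSize k (j + 1) + 17 + 3 * k = t + 2 ^ t := by
          rw [refinementSize, ← ht]
          omega
      _ ≤ 2 ^ (t + 1) := by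
          rw [pow_succ]
          omega
      _ ≤ 2 ^ 2 ^ t := Nat.pow_le_pow_right two_pos h2
      _ ≤ _ := by
        rw [h1]
        exact Nat.pow_le_pow_right two_pos (Nat.pow_le_pow_right two_pos ih)

variable {V : Type*} [Fintype V] {T : V → V → V → Prop}

lemma logStar_card_le (hT : IsTriangleSystem T) {d : ℝ} (hd : 0 < d)
    (hcount : count T = d * Fintype.card V ^ 2) {k : ℕ} (hk : 1 ≤ d * 2 ^ k) :
    logStar (Fintype.card V : ℝ) ≤ 257 * k + 7 := by
  rw [logStar_le_iff]
  have h1 := card_lt hT hd hcount hk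
  have h2 := refinementSize_le_tower k (128 * k + 1)
  have h3 : tower (257 * k + 7) = 2 ^ tower (k + 4 + 2 * (128 * k + 1)) := by
    rw [show 257 * k + 7 = k + 4 + 2 * (128 * k + 1) + 1 by ring, tower]
  have h4 : Fintype.card V ≤ tower (257 * k + 7) := by
    rw [h3]
    exact h1.le.trans (Nat.pow_le_pow_right two_pos (by omega))
  exact_mod_cast h4

theorem count_le_div (hT : IsTriangleSystem T) :
    count T ≤ (Fintype.card V : ℝ) ^ 2 /
      2 ^ ((1 / 1313 : ℝ) * (logStar (Fintype.card V : ℝ) : ℝ)) := by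
  rcases Nat.lt_or_ge (Fintype.card V) 2 with hV | hV
  · have h0 : logStar (Fintype.card V : ℝ) = 0 := by
      rw [← Nat.le_zero, logStar_le_iff]
      exact_mod_cast Nat.le_of_lt_succ hV
    rw [h0]
    simpa using count_le hT
  have hn : (0 : ℝ) < Fintype.card V := by exact_mod_cast two_pos.trans_le hV
  obtain ⟨d, hcount⟩ : ∃ d, count T = d * (Fintype.card V : ℝ) ^ 2 :=
    ⟨count T / (Fintype.card V : ℝ) ^ 2, by field_simp⟩
  rcases le_or_gt d 0 with hd | hd
  · rw [hcount]
    exact (mul_nonpos_of_nonpos_of_nonneg hd (by positivity)).trans (by positivity)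
  have hd1 := density_le hT hd hcount hV
  set l := Real.logb 2 d⁻¹ with hl
  have hdl : (2 : ℝ) ^ l = d⁻¹ :=
    Real.rpow_logb two_pos (by norm_num) (inv_pos.2 hd)
  -- This follows from `(5 / 4) ^ 4 ≥ 2`. It lets a multiple of `l` absorb additive constants: `257
  -- * (l + 1) + 7 ≤ (257 + 4 * 264) * l = 1313 * l`.
  have hl4 : 1 / 4 ≤ l := by
    rw [hl, Real.le_logb_iff_rpow_le one_lt_two (inv_pos.2 hd)]
    have h1 : (5 / 4 : ℝ) ≤ d⁻¹ := by
      rw [le_inv_comm₀ (by norm_num) hd]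
      linarith
    refine le_trans ?_ h1
    rw [← Real.rpow_le_rpow_iff (z := 4) (by positivity) (by norm_num) (by norm_num),
      ← Real.rpow_mul (by norm_num)]
    norm_num
  have hk : 1 ≤ d * 2 ^ ⌈l⌉₊ := by
    have h1 : d⁻¹ ≤ 2 ^ ⌈l⌉₊ := by
      rw [← hdl, ← Real.rpow_natCast]
      exact Real.rpow_le_rpow_of_exponent_le one_le_two (Nat.le_ceil l)
    calc 1 = d * d⁻¹ := (mul_inv_cancel₀ hd.ne').symm
      _ ≤ _ := by gcongr
  have hL : (logStar (Fintype.card V : ℝ) : ℝ) ≤ 257 * ⌈l⌉₊ + 7 := by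
    exact_mod_cast logStar_card_le hT hd hcount hk
  have hceil := Nat.ceil_lt_add_one (show 0 ≤ l by linarith)
  rw [hcount, le_div_iff₀ (by positivity), mul_right_comm]
  refine mul_le_of_le_one_left (by positivity) ?_
  calc d * 2 ^ ((1 / 1313 : ℝ) * (logStar (Fintype.card V : ℝ) : ℝ)) ≤ d * 2 ^ l := by
        gcongr
        · exact one_le_two
        · linarith
    _ = 1 := by rw [hdl, mul_inv_cancel₀ hd.ne']

end TriangleSystem

/-! ### From zeroings out to triangle systems -/

/-- The triangles of the tripartite graph given by three sets of pairs. -/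
def IsTriangle {V : Type*} (A B C : Set (V × V)) (x y z : V) : Prop :=
  (x, y) ∈ A ∧ (y, z) ∈ B ∧ (z, x) ∈ C

section MatMul

variable {F : Type*} [Field F] {N : ℕ} {A B C : Set (Fin N × Fin N)}

lemma zeroOut_matMulTensor_ne_zero {x y z : Fin N} (h : IsTriangle A B C x y z) :
    (matMulTensor F N N N).zeroOut A B C (x, y) (y, z) (z, x) ≠ 0 := by
  rw [Tensor3.zeroOut, if_pos (show (x, y) ∈ A ∧ (y, z) ∈ B ∧ (z, x) ∈ C from h)]
  simp [matMulTensor]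

lemma supp_zeroOut_matMulTensor :
    Tensor3.supp ((matMulTensor F N N N).zeroOut A B C) =
      (fun p : Fin N × Fin N × Fin N => ((p.1, p.2.1), (p.2.1, p.2.2), (p.2.2, p.1))) ''
        {p | IsTriangle A B C p.1 p.2.1 p.2.2} := by
  ext ⟨⟨x, y⟩, ⟨y', z⟩, ⟨z', x'⟩⟩
  constructor
  · intro h
    simp only [Tensor3.supp, Tensor3.zeroOut, matMulTensor, Set.mem_ofPred_eq, ne_eq, ite_eq_right_iff,
      Classical.not_imp] at h
    obtain ⟨h1, ⟨rfl, rfl, rfl⟩, -⟩ := h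
    exact ⟨(x', y, z), h1, rfl⟩
  · rintro ⟨⟨a, b, c⟩, h, heq⟩
    simp only [Prod.mk.injEq] at heq
    obtain ⟨⟨rfl, rfl⟩, ⟨rfl, rfl⟩, rfl, rfl⟩ := heq
    exact zeroOut_matMulTensor_ne_zero h

/-- Uniqueness of each variable is edge-disjointness. Closure is automatic, because a zeroing out
selects edges rather than triangles. -/
lemma isTriangleSystem_of_isPermIdentity {k : ℕ}
    (h : Tensor3.IsPermIdentity ((matMulTensor F N N N).zeroOut A B C) k) :
    IsTriangleSystem (IsTriangle A B C) where
  fst_unique h1 h2 := congrArg Prod.fst (h.snd_unique _ _ _ _ _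
    (zeroOut_matMulTensor_ne_zero h1) (zeroOut_matMulTensor_ne_zero h2)).1
  snd_unique h1 h2 := congrArg Prod.snd (h.trd_unique _ _ _ _ _
    (zeroOut_matMulTensor_ne_zero h1) (zeroOut_matMulTensor_ne_zero h2)).1
  trd_unique h1 h2 := congrArg Prod.snd (h.fst_unique _ _ _ _ _
    (zeroOut_matMulTensor_ne_zero h1) (zeroOut_matMulTensor_ne_zero h2)).1
  closed h1 h2 h3 := ⟨h1.1, h2.2.1, h3.2.2⟩

lemma count_of_isPermIdentity {k : ℕ}
    (h : Tensor3.IsPermIdentity ((matMulTensor F N N N).zeroOut A B C) k) :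
    TriangleSystem.count (IsTriangle A B C) = k := by
  have h1 := h.ncard_supp
  rw [supp_zeroOut_matMulTensor, Set.ncard_image_of_injective, Set.ncard_eq_toFinset_card'] at h1
  · rw [← h1, TriangleSystem.count]
    simp only [TriangleSystem.ind, Set.toFinset_ofPred, card_filter, Nat.cast_sum,
      Fintype.sum_prod_type]
    push_cast
    rfl
  · rintro ⟨a, b, c⟩ ⟨a', b', c'⟩ heq
    simp only [Prod.mk.injEq] at heq ⊢
    tauto

variable (F N) in
theorem zeroOutSubrank_matMulTensor_le :
    ((matMulTensor F N N N).zeroOutSubrank : ℝ) ≤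
      (N : ℝ) ^ 2 / (2 : ℝ) ^ ((1 / 1313 : ℝ) * (logStar (N : ℝ) : ℝ)) := by
  obtain ⟨A, B, C, h⟩ := (Tensor3.isGreatest_zeroOutSubrank (matMulTensor F N N N)).1
  rw [← count_of_isPermIdentity h]
  simpa using TriangleSystem.count_le_div (isTriangleSystem_of_isPermIdentity h)

end MatMul

end

theorem mainTheorem2 :
    (∃ c : ℝ, 0 < c ∧ ∀ (F : Type*) [Field F] (N : ℕ),
      ((matMulTensor F N N N).zeroOutSubrank : ℝ) ≤
        (N : ℝ) ^ 2 / (2 : ℝ) ^ (c * (logStar (N : ℝ) : ℝ))) ∧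
    (∀ (F : Type*) [Field F],
      (fun N : ℕ => ((matMulTensor F N N N).zeroOutSubrank : ℝ))
        =o[Filter.atTop] (fun N : ℕ => (N : ℝ) ^ 2)) := by
  refine ⟨⟨1 / 1313, by norm_num, fun F _ N => zeroOutSubrank_matMulTensor_le F N⟩, fun F _ => ?_⟩
  rw [Asymptotics.isLittleO_iff]
  intro ε hε
  have h1 : Filter.Tendsto (fun N : ℕ => (1 / 1313 : ℝ) * (logStar (N : ℝ) : ℝ))
      Filter.atTop Filter.atTop :=
    (tendsto_natCast_atTop_atTop.comp tendsto_logStar_natCast).const_mul_atTop (by norm_num)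
  have h2 := (tendsto_rpow_atTop_of_base_gt_one 2 one_lt_two).comp h1
  filter_upwards [h2.eventually_ge_atTop ε⁻¹] with N hN
  rw [Real.norm_of_nonneg (by positivity), Real.norm_of_nonneg (by positivity)]
  refine (zeroOutSubrank_matMulTensor_le F N).trans ?_
  rw [div_le_iff₀ (by positivity)]
  have h3 : 1 ≤ ε * (2 : ℝ) ^ ((1 / 1313 : ℝ) * (logStar (N : ℝ) : ℝ)) := by
    exact (mul_inv_cancel₀ hε.ne').symm.le.trans (mul_le_mul_of_nonneg_left hN hε.le)
  nlinarith [sq_nonneg (N : ℝ)]
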